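/- **Setting.** Let $E$ be a random outcome and $A_1,\dots,A_m$ base signals, all with finitely many values, with joint prior $P$. For $O\subseteq\{1,\dots,m\}$ let $A_O$ be the signal that reveals $A_s$ for all $s\in O$. A *garbling* of $A_O$ is a signal that is a (measurable) function of $A_O$ and of a uniform random seed in $[0,1]$ independent of $(A_1,\dots,A_m,E)$; these are the signals $A'\preceq A_O$ of the continuous signal lattice. Write $A\vee B$ for the signal that reveals both $A$ and $B$. Let $S:\Delta_E\times E\to\mathbb R$ be a (measurable) strictly proper scoring rule: for every belief $q\in\Delta_E$, the expected score $\sum_e q(e)S(r,e)$ is maximized over $r\in\Delta_E$ only by $r=q$. The value of a signal $A$ is $V(A)=\mathbb E_{a}\big[\max_{r\in\Delta_E}\mathbb E[S(r,E)\mid A=a]\big]$. The signals are *strict, strong substitutes* with respect to $S$ if for all $O,Q\subseteq\{1,\dots,m\}$ and every garbling $A'$ of $A_O$, $$V(A'\vee A_Q)-V(A')\ \ge\ V(A_O\vee A_Q)-V(A_O),$$ with strict inequality whenever neither of $O,Q$ contains the other and $A'$ is strictly less informative than $A_O$ (i.e. $A'$ does not almost surely determine $A_O$). **Market.** There are finitely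 many traders; trader $j$ privately observes $A_{O_j}$ for some $O_j\subseteq\{1,\dots,m\}$. The initial prediction $p^{(0)}$ is the prior distribution of $E$. At each step $t=1,\dots,T$ a designated trader $i_t$ sees all predictions so far and moves the current prediction $p^{(t-1)}\in\Delta_E$ to any $p^{(t)}\in\Delta_E$. Trader $j$'s payoff is $\sum_{t:\,i_t=j}\big(S(p^{(t)},E)-S(p^{(t-1)},E)\big)$. A strategy specifies a report at each of the trader's steps as a (measurable) function of her signal, the past predictions, and a private uniform seed independent of everything else. A profile is a Bayes–Nash equilibrium if the scores $S(p^{(t)},E)$, $0\le t\le T$, have finite expectation and no trader can raise her ex ante expected payoff by changing her own strategy (to one under which her payoff has finite expectation). Trader $i_t$ *reports truthfully* at $t$ if, almost surely, $p^{(t)}$ is the conditional distribution of $E$ given her signal and $p^{(0)},\dots,p^{(t-1)}$. Number the traders who get to trade $1,2,\dots,k$ in order of their first trading opportunity. A profile is *all-rush* if each trader $i<k$ reports truthfully at some step before trader $i+1$'s first trading opportunity, and trader $k$ reports truthfully at some step $t\le T$. **Theorem.** Suppose the signals are strict, strong substitutes with respect to $S$. Then for every set of traders and every trading order such that each trader $i\ge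 2$ observes at least one base signal not observed by any of the traders $1,\dots,i-1$ (that is, $O_i\not\subseteq O_1\cup\dots\cup O_{i-1}$), every Bayes–Nash equilibrium is all-rush. -/

import Mathlib

open MeasureTheory

noncomputable section

/-! ### Predictions and scoring rules -/

/-- A prediction: a probability distribution on the finite set of outcomes `E`. -/
abbrev Prediction (E : Type*) [Fintype E] : Type _ := ↥(stdSimplex ℝ E)

/-- `S r e` is the score of the prediction `r` when the outcome is `e`. The rule is strictly proper
if the expected score under any belief `q` is uniquely maximized by reporting `q`. -/
def StrictlyProper {E : Type*} [Fintype E] (S : Prediction E → E → ℝ) : Prop :=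
  ∀ q r : Prediction E, r ≠ q → ∑ e, q.1 e * S r e < ∑ e, q.1 e * S q e

/-! ### Posteriors and the value of information

A signal on a probability space `Ω` is represented by the σ-algebra of events that it reveals (the
measurable form of an information partition): `m' ≤ m` says that `m'` is coarser than `m`, and
`m ⊔ m'` is the signal of an agent who observes both. -/

/-- The posterior probability of the outcome `e` given the signal `m`. -/
def posterior {Ω E : Type*} {mΩ : MeasurableSpace Ω} (μ : Measure Ω) (out : Ω → E)
    (m : MeasurableSpace Ω) (e : E) : Ω → ℝ :=
  μ[Set.indicator (out ⁻¹' {e}) (fun _ => (1 : ℝ)) | m]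

/-- The value of the signal `m` in the decision problem with decision space `D` and utility `u`:
the expected utility of an agent who observes `m` and then takes an optimal decision. -/
def signalValue {Ω E D : Type*} {mΩ : MeasurableSpace Ω} [Fintype E] (μ : Measure Ω)
    (out : Ω → E) (u : D → E → ℝ) (m : MeasurableSpace Ω) : ℝ :=
  ∫ ω, ⨆ d : D, ∑ e, posterior μ out m e ω * u d e ∂μ

/-- The signal `m'` almost surely reveals the signal `m`: up to null sets, every event of `m` is
an event of `m'`. -/
def Reveals {Ω : Type*} {mΩ : MeasurableSpace Ω} (μ : Measure Ω) (m' m : MeasurableSpace Ω) : Prop :=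
  ∀ X : Set Ω, MeasurableSet[m] X → ∃ Y : Set Ω, MeasurableSet[m'] Y ∧ X =ᵐ[μ] Y

/-! ### Strong substitutes

The base signals are indexed by `I`; the base signal `s` takes values in `A s`. The prior is a
probability measure on `(∀ s, A s) × E`. Randomized functions of signals are modelled as
deterministic functions of the signal and of a uniform seed in `[0,1]` that is independent of all
base signals and of the outcome. -/

section Substitutes

variable {I : Type*} {A : I → Type*} {E : Type*}
  [∀ s, MeasurableSpace (A s)] [MeasurableSpace E]

/-- The prior together with an independent uniform seed. -/
def seededPrior (P : Measure ((∀ s, A s) × E)) :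
    Measure (((∀ s, A s) × E) × unitInterval) :=
  P.prod volume

/-- The subsets-lattice signal `A_S`: observe the realizations of the base signals in `S`. -/
abbrev subsetSignal (S : Finset I) : MeasurableSpace (((∀ s, A s) × E) × unitInterval) :=
  MeasurableSpace.comap (fun ω (s : S) => ω.1.1 s) inferInstance

/-- The signal `A_S` together with the random seed. The signals of the continuous lattice that lie
below `A_S` (the garblings of `A_S`) are those coarser than this one. -/
abbrev seededSubsetSignal (S : Finset I) : MeasurableSpace (((∀ s, A s) × E) × unitInterval) :=
  MeasurableSpace.comap (fun ω => ((fun (s : S) => ω.1.1 s), ω.2)) inferInstance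

/-- Strict, strong substitutes for the decision problem `u`: for `A_S`, `A_T` on the subsets lattice
and a garbling `m` of `A_S`, the marginal value of `A_T` over `m` is at least its marginal value
over `A_S`; and it is strictly larger whenever `A_S` and `A_T` are incomparable and `m` is strictly
less informative than `A_S`, that is, does not almost surely reveal `A_S`. -/
def StrictStrongSubstitutes [Fintype E] {D : Type*} (P : Measure ((∀ s, A s) × E))
    (u : D → E → ℝ) : Prop :=
  let V : MeasurableSpace (((∀ s, A s) × E) × unitInterval) → ℝ :=
    signalValue (seededPrior P) (fun ω => ω.1.2) u
  ∀ (S T : Finset I) (m : MeasurableSpace (((∀ s, A s) × E) × unitInterval)),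
    m ≤ seededSubsetSignal S →
      V (subsetSignal S ⊔ subsetSignal T) - V (subsetSignal S) ≤ V (m ⊔ subsetSignal T) - V m ∧
      (¬ S ⊆ T → ¬ T ⊆ S → ¬ Reveals (seededPrior P) m (subsetSignal S) →
        V (subsetSignal S ⊔ subsetSignal T) - V (subsetSignal S) < V (m ⊔ subsetSignal T) - V m)

end Substitutes

/-! ### The market

The traders are the elements of `J`; trader `j` observes the base signals in `obs j`. There are `N`
trading steps, numbered `0, …, N - 1`; at step `t` trader `order t` moves the market prediction from
`p⁽ᵗ⁾` to `p⁽ᵗ⁺¹⁾` (values of `order` at `N` and beyond play no role). Randomization is by private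
seeds: trader `j` has a uniform seed in `[0,1]`, independent of everything else. -/

/-- A (randomized) strategy of a trader who observes the base signals in `O`: for each step `t`,
a report as a function of her signal, her seed and the predictions `p⁽⁰⁾, …, p⁽ᵗ⁾` so far. -/
structure Strategy {I : Type*} (A : I → Type*) (E : Type*) [∀ s, MeasurableSpace (A s)]
    [Fintype E] (O : Finset I) where
  act : (t : ℕ) → ((s : O) → A s) → unitInterval → (Fin (t + 1) → Prediction E) → Prediction E
  measurable_act : ∀ t, Measurable
    (fun x : ((s : O) → A s) × unitInterval × (Fin (t + 1) → Prediction E) =>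
      act t x.1 x.2.1 x.2.2)

section Market

variable {I : Type*} {A : I → Type*} {E : Type*} {J : Type*}
  [∀ s, MeasurableSpace (A s)] [Fintype E] [MeasurableSpace E]

/-- The prior distribution of the outcome, which is the initial market prediction. -/
def priorPrediction [MeasurableSingletonClass E] (P : Measure ((∀ s, A s) × E))
    [IsProbabilityMeasure P] : Prediction E :=
  ⟨fun e => P.real (Prod.snd ⁻¹' {e}), fun _ => measureReal_nonneg, by
    rw [sum_measureReal_preimage_singleton Finset.univ
      (fun y _ => measurable_snd (measurableSet_singleton y))]
    simp⟩

/-- The joint law of the base signals, the outcome and the traders' private seeds. -/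
def marketMeasure [Fintype J] (P : Measure ((∀ s, A s) × E)) :
    Measure (((∀ s, A s) × E) × (J → unitInterval)) :=
  P.prod (Measure.pi fun _ => volume)

/-- The sequence of predictions `p⁽⁰⁾, …, p⁽ᵗ⁾` when the market starts at `p₀` and the
strategy profile `σ` is played. -/
def history (p₀ : Prediction E) {obs : J → Finset I} (order : ℕ → J)
    (σ : (j : J) → Strategy A E (obs j)) :
    (t : ℕ) → ((∀ s, A s) × E) × (J → unitInterval) → (Fin (t + 1) → Prediction E)
  | 0, _ => fun _ => p₀
  | t + 1, ω =>
      Fin.snoc (α := fun _ => Prediction E) (history p₀ order σ t ω)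
        ((σ (order t)).act t (fun s => ω.1.1 s) (ω.2 (order t)) (history p₀ order σ t ω))

/-- The market prediction `p⁽ᵗ⁾`. -/
def price (p₀ : Prediction E) {obs : J → Finset I} (order : ℕ → J)
    (σ : (j : J) → Strategy A E (obs j)) (t : ℕ)
    (ω : ((∀ s, A s) × E) × (J → unitInterval)) : Prediction E :=
  history p₀ order σ t ω (Fin.last t)

/-- Trader `j`'s payoff: the sum of `S(p⁽ᵗ⁺¹⁾, e) - S(p⁽ᵗ⁾, e)` over the steps `t` at which
she trades. -/
def payoff [DecidableEq J] (S : Prediction E → E → ℝ) (p₀ : Prediction E) {obs : J → Finset I}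
    (order : ℕ → J) (N : ℕ) (σ : (j : J) → Strategy A E (obs j)) (j : J)
    (ω : ((∀ s, A s) × E) × (J → unitInterval)) : ℝ :=
  ∑ t ∈ (Finset.range N).filter (fun t => order t = j),
    (S (price p₀ order σ (t + 1) ω) ω.1.2 - S (price p₀ order σ t ω) ω.1.2)

/-- Bayes–Nash equilibrium: the scores on the path of play have finite expectation (automatic if
`S` is bounded), and no trader can raise her expected payoff by a unilateral change of strategy
under which her payoff has a finite expectation. -/
def IsBayesNash [MeasurableSingletonClass E] [Fintype J] [DecidableEq J]
    (P : Measure ((∀ s, A s) × E)) [IsProbabilityMeasure P] (S : Prediction E → E → ℝ)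
    {obs : J → Finset I} (order : ℕ → J) (N : ℕ) (σ : (j : J) → Strategy A E (obs j)) : Prop :=
  (∀ t ≤ N, Integrable (fun ω => S (price (priorPrediction P) order σ t ω) ω.1.2)
    (marketMeasure P)) ∧
  ∀ (j : J) (τ : Strategy A E (obs j)),
    Integrable (payoff S (priorPrediction P) order N (Function.update σ j τ) j)
      (marketMeasure P) →
    ∫ ω, payoff S (priorPrediction P) order N (Function.update σ j τ) j ω ∂(marketMeasure P) ≤
      ∫ ω, payoff S (priorPrediction P) order N σ j ω ∂(marketMeasure P)

/-- The information of the trader who trades at step `t`: her signal and the predictions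
`p⁽⁰⁾, …, p⁽ᵗ⁾`. -/
abbrev traderInfo (p₀ : Prediction E) {obs : J → Finset I} (order : ℕ → J)
    (σ : (j : J) → Strategy A E (obs j)) (t : ℕ) :
    MeasurableSpace (((∀ s, A s) × E) × (J → unitInterval)) :=
  MeasurableSpace.comap
    (fun ω => ((fun (s : obs (order t)) => ω.1.1 s), history p₀ order σ t ω)) inferInstance

/-- The trader who trades at step `t` reports truthfully: almost surely she moves the market
prediction to her current posterior distribution on the outcome. -/
def TruthfulAt [MeasurableSingletonClass E] [Fintype J] (P : Measure ((∀ s, A s) × E))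
    [IsProbabilityMeasure P] {obs : J → Finset I} (order : ℕ → J)
    (σ : (j : J) → Strategy A E (obs j)) (t : ℕ) : Prop :=
  ∀ e, (fun ω => (price (priorPrediction P) order σ (t + 1) ω).1 e) =ᵐ[marketMeasure P]
    posterior (marketMeasure P) (fun ω => ω.1.2)
      (traderInfo (priorPrediction P) order σ t) e

/-- Step `t` is the first trading opportunity of trader `j`. -/
def FirstTrade (order : ℕ → J) (N : ℕ) (j : J) (t : ℕ) : Prop :=
  t < N ∧ order t = j ∧ ∀ t' < t, order t' ≠ j

/-- All-rush: every trader who gets to trade reports truthfully at some step before the first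
trading opportunity of the trader who arrives next (hence of all who arrive after her), the last
trader to arrive doing so before the market closes. -/
def AllRush [MeasurableSingletonClass E] [Fintype J] (P : Measure ((∀ s, A s) × E))
    [IsProbabilityMeasure P] {obs : J → Finset I} (order : ℕ → J) (N : ℕ)
    (σ : (j : J) → Strategy A E (obs j)) : Prop :=
  ∀ (j : J) (t₀ : ℕ), FirstTrade order N j t₀ →
    ∃ t < N, order t = j ∧ TruthfulAt P order σ t ∧
      ∀ (k : J) (t₁ : ℕ), FirstTrade order N k t₁ → t₀ < t₁ → t < t₁

/-- Every trader other than the first to arrive observes at least one base signal that is not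
observed by any trader who arrived before her. -/
def ArrivalsInformative (obs : J → Finset I) (order : ℕ → J) (N : ℕ) : Prop :=
  ∀ (j : J) (t : ℕ), FirstTrade order N j t → 0 < t →
    ∃ s ∈ obs j, ∀ t' < t, s ∉ obs (order t')

end Market

end

/-!
A trader who arrives at step `t` can report truthfully once and then leave the market alone. In
equilibrium she therefore earns at least the marginal value of her signal over the public history,
and since the history garbles the signals pooled by the earlier traders, substitutability bounds
this below by her marginal value over the pool. These lower bounds telescope to the value of all
the signals, which no market can pay out in excess, so each of them is an equality. Strictness of
the substitutes then forces the score at each arrival, and at the close, to equal the value of the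
pool. The current trader has by then collected her whole equilibrium payoff, so at her last step
before the next arrival her prediction is worth all of her information; as that information is
worth the whole pool, the prediction is her posterior.
-/

section CondExp

variable {Ω : Type*} {m mΩ : MeasurableSpace Ω} {μ : Measure Ω} {g : Ω → ℝ}

theorem lintegral_ofReal_condExp_mul (hm : m ≤ mΩ) [SigmaFinite (μ.trim hm)]
    (hg : Integrable g μ) (hg0 : 0 ≤ᵐ[μ] g) {f : Ω → ENNReal} (hf : Measurable[m] f) :
    ∫⁻ ω, ENNReal.ofReal (μ[g | m] ω) * f ω ∂μ = ∫⁻ ω, ENNReal.ofReal (g ω) * f ω ∂μ := by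
  have h_trim : (μ.withDensity fun ω => ENNReal.ofReal (μ[g | m] ω)).trim hm =
      (μ.withDensity fun ω => ENNReal.ofReal (g ω)).trim hm := by
    refine @Measure.ext _ m _ _ fun s hs => ?_
    rw [trim_measurableSet_eq hm hs, trim_measurableSet_eq hm hs, withDensity_apply _ (hm s hs),
      withDensity_apply _ (hm s hs),
      ← ofReal_integral_eq_lintegral_ofReal integrable_condExp.integrableOn
        (ae_restrict_of_ae (condExp_nonneg hg0)),
      ← ofReal_integral_eq_lintegral_ofReal hg.integrableOn (ae_restrict_of_ae hg0),
      setIntegral_condExp hm hg hs]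
  have h_density {h : Ω → ℝ} (hh : Integrable h μ) :
      ∫⁻ ω, ENNReal.ofReal (h ω) * f ω ∂μ =
        ∫⁻ ω, f ω ∂(μ.withDensity fun ω => ENNReal.ofReal (h ω)).trim hm := by
    rw [lintegral_trim hm hf, lintegral_withDensity_eq_lintegral_mul₀
      hh.aemeasurable.ennreal_ofReal (hf.mono hm le_rfl).aemeasurable]
    rfl
  rw [h_density integrable_condExp, h_density hg, h_trim]

theorem integrable_condExp_mul_iff (hm : m ≤ mΩ) [SigmaFinite (μ.trim hm)]
    (hg : Integrable g μ) (hg0 : 0 ≤ᵐ[μ] g) {f : Ω → ℝ} (hf : Measurable[m] f) :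
    Integrable (fun ω => μ[g | m] ω * f ω) μ ↔ Integrable (fun ω => g ω * f ω) μ := by
  have h_enorm {h : Ω → ℝ} (hh : Integrable h μ) (hh0 : 0 ≤ᵐ[μ] h) :
      Integrable (fun ω => h ω * f ω) μ ↔ ∫⁻ ω, ENNReal.ofReal (h ω) * ‖f ω‖ₑ ∂μ < ⊤ := by
    have h_meas : AEStronglyMeasurable (fun ω => h ω * f ω) μ :=
      hh.1.mul (hf.mono hm le_rfl).aestronglyMeasurable
    rw [Integrable, and_iff_right h_meas, hasFiniteIntegral_iff_enorm]
    refine iff_of_eq (congrArg (· < ⊤) (lintegral_congr_ae ?_))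
    filter_upwards [hh0] with ω hω
    rw [enorm_mul, Real.enorm_eq_ofReal hω]
  rw [h_enorm integrable_condExp (condExp_nonneg hg0), h_enorm hg hg0,
    lintegral_ofReal_condExp_mul hm hg hg0 (f := fun ω => ‖f ω‖ₑ)
      (measurable_enorm.comp hf)]

theorem integral_condExp_mul (hm : m ≤ mΩ) [SigmaFinite (μ.trim hm)] (hg : Integrable g μ)
    {f : Ω → ℝ} (hf : Measurable[m] f) (hgf : Integrable (fun ω => g ω * f ω) μ) :
    ∫ ω, μ[g | m] ω * f ω ∂μ = ∫ ω, g ω * f ω ∂μ := by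
  rw [← integral_condExp hm (f := fun ω => g ω * f ω)]
  exact (integral_congr_ae
    (condExp_mul_of_stronglyMeasurable_right hf.stronglyMeasurable hgf hg)).symm

theorem Reveals.sup_left {m' : MeasurableSpace Ω} (h : Reveals μ m' m) : Reveals μ m' (m' ⊔ m) :=
  (sup_le le_eventuallyMeasurableSpace h : m' ⊔ m ≤ eventuallyMeasurableSpace m' (ae μ))

theorem Reveals.condExp_ae_eq {m' : MeasurableSpace Ω} (hr : Reveals μ m' m) (hle : m' ≤ m)
    (hm : m ≤ mΩ) [SigmaFinite (μ.trim (hle.trans hm))] (hg : Integrable g μ) :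
    μ[g | m'] =ᵐ[μ] μ[g | m] := by
  have : SigmaFinite (μ.trim hm) := sigmaFiniteTrim_mono hm hle
  refine ae_eq_condExp_of_forall_setIntegral_eq hm hg
    (fun _ _ _ => integrable_condExp.integrableOn) (fun X hX _ => ?_)
    (stronglyMeasurable_condExp.mono hle).aestronglyMeasurable
  obtain ⟨Y, hY, hXY⟩ := hr X hX
  rw [setIntegral_congr_set hXY, setIntegral_congr_set hXY,
    setIntegral_condExp (hle.trans hm) hg hY]

variable {Ω' : Type*} {mΩ' : MeasurableSpace Ω'} {μ' : Measure Ω'}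

theorem condExp_comp_of_measurePreserving [IsFiniteMeasure μ] [IsFiniteMeasure μ']
    {ψ : Ω' → Ω} (hψ : MeasurePreserving ψ μ' μ) (hg : Integrable g μ) (hm : m ≤ mΩ) :
    μ'[g ∘ ψ | m.comap ψ] =ᵐ[μ'] μ[g | m] ∘ ψ := by
  have h_setIntegral {s : Set Ω} (hs : MeasurableSet[m] s) {h : Ω → ℝ} (hh : Integrable h μ) :
      ∫ x in ψ ⁻¹' s, (h ∘ ψ) x ∂μ' = ∫ x in s, h x ∂μ := by
    rw [← hψ.map_eq] at hh ⊢
    exact (setIntegral_map (hm s hs) hh.1 hψ.measurable.aemeasurable).symm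
  refine (ae_eq_condExp_of_forall_setIntegral_eq
    ((MeasurableSpace.comap_mono hm).trans hψ.measurable.comap_le)
    (hψ.integrable_comp_of_integrable hg)
    (fun _ _ _ => (hψ.integrable_comp_of_integrable integrable_condExp).integrableOn) ?_
    (stronglyMeasurable_condExp.comp_measurable
      (comap_measurable ψ)).aestronglyMeasurable).symm
  rintro _ ⟨s, hs, rfl⟩ -
  rw [h_setIntegral hs integrable_condExp, h_setIntegral hs hg, setIntegral_condExp hm hg hs]

theorem condExp_prod_fst {α β : Type*} {m mα : MeasurableSpace α} {mβ : MeasurableSpace β}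
    {P : Measure α} {ν : Measure β} [IsFiniteMeasure P] [IsProbabilityMeasure ν] {g : α → ℝ}
    (hg : Integrable g P) (hm : m ≤ mα) :
    (P.prod ν)[g ∘ Prod.fst | m.prod mβ] =ᵐ[P.prod ν] P[g | m] ∘ Prod.fst := by
  have h_le : m.prod mβ ≤ mα.prod mβ := sup_le_sup (MeasurableSpace.comap_mono hm) le_rfl
  have h_fst := measurePreserving_fst (μ := P) (ν := ν)
  have h_setIntegral {s : Set (α × β)} (hs : MeasurableSet[m.prod mβ] s) {h : α → ℝ}
      (hh : Integrable h P) : ∫ x in s, (h ∘ Prod.fst) x ∂(P.prod ν) =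
        ∫ y, ∫ x in (fun x => (x, y)) ⁻¹' s, h x ∂P ∂ν := by
    rw [← integral_indicator (h_le s hs), integral_prod_symm _
      ((h_fst.integrable_comp_of_integrable hh).indicator (h_le s hs))]
    refine integral_congr_ae (.of_forall fun y => ?_)
    exact integral_indicator (f := h) (measurable_prodMk_right (y := y) (h_le s hs))
  refine (ae_eq_condExp_of_forall_setIntegral_eq h_le (h_fst.integrable_comp_of_integrable hg)
    (fun _ _ _ => (h_fst.integrable_comp_of_integrable integrable_condExp).integrableOn) ?_
    (stronglyMeasurable_condExp.comp_measurable
      (@measurable_fst α β m mβ)).aestronglyMeasurable).symm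
  intro s hs _
  rw [h_setIntegral hs integrable_condExp, h_setIntegral hs hg]
  refine integral_congr_ae (.of_forall fun y => ?_)
  exact setIntegral_condExp hm hg (@measurable_prodMk_right α β m mβ y s hs)

end CondExp

section ScoringRule

variable {E : Type*} [Fintype E] {S : Prediction E → E → ℝ}

namespace StrictlyProper

theorem le (hS : StrictlyProper S) (q r : Prediction E) :
    ∑ e, q.1 e * S r e ≤ ∑ e, q.1 e * S q e := by
  rcases eq_or_ne r q with rfl | h
  · exact le_rfl
  · exact (hS q r h).le

theorem iSup_eq (hS : StrictlyProper S) (q : Prediction E) :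
    ⨆ r : Prediction E, ∑ e, q.1 e * S r e = ∑ e, q.1 e * S q e :=
  have : Nonempty (Prediction E) := ⟨q⟩
  IsLUB.ciSup_eq <| IsGreatest.isLUB ⟨Set.mem_range_self q, Set.forall_mem_range.2 (hS.le q)⟩

theorem exists_score_le (hS : StrictlyProper S) : ∃ M, 0 ≤ M ∧ ∀ r e, S r e ≤ M := by
  classical
  let certain (e : E) : Prediction E := ⟨Pi.single e 1, single_mem_stdSimplex ℝ e⟩
  refine ⟨∑ e, |S (certain e) e|, Finset.sum_nonneg fun _ _ => abs_nonneg _, fun r e => ?_⟩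
  have h : S r e ≤ S (certain e) e := by
    simpa [certain, Pi.single_apply] using hS.le (certain e) r
  exact (h.trans (le_abs_self _)).trans
    (Finset.single_le_sum (f := fun e => |S (certain e) e|) (fun _ _ => abs_nonneg _)
      (Finset.mem_univ e))

-- The total `∑ e, q e * S q e` is bounded below by the expected score of a fixed report.
theorem exists_abs_mul_score_le (hS : StrictlyProper S) :
    ∃ C, ∀ (q : Prediction E) e, |q.1 e * S q e| ≤ C := by
  classical
  obtain ⟨M, hM0, hM⟩ := hS.exists_score_le
  rcases isEmpty_or_nonempty (Prediction E) with _ | ⟨⟨r⟩⟩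
  · exact ⟨0, isEmptyElim⟩
  have h_upper (q : Prediction E) (e : E) : q.1 e * S q e ≤ M :=
    (mul_le_mul_of_nonneg_left (hM q e) (q.2.1 e)).trans
      (mul_le_of_le_one_left hM0 (stdSimplex.le_one q e))
  have h_lower (q : Prediction E) (e : E) :
      -(∑ e, |S r e| + ∑ _e : E, M) ≤ q.1 e * S q e := by
    have h_others : ∑ e' ∈ Finset.univ.erase e, q.1 e' * S q e' ≤ ∑ _e : E, M :=
      (Finset.sum_le_sum fun e' _ => h_upper q e').trans
        (Finset.sum_le_sum_of_subset_of_nonneg (Finset.subset_univ _) fun _ _ _ => hM0)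
    have h_fixed : -∑ e, |S r e| ≤ ∑ e, q.1 e * S r e := by
      rw [← Finset.sum_neg_distrib]
      refine Finset.sum_le_sum fun e _ => neg_le_of_abs_le ?_
      rw [abs_mul, abs_of_nonneg (q.2.1 e)]
      exact mul_le_of_le_one_left (abs_nonneg _) (stdSimplex.le_one q e)
    have h_split := Finset.add_sum_erase Finset.univ (fun e => q.1 e * S q e) (Finset.mem_univ e)
    linarith [hS.le q r]
  exact ⟨max M (∑ e, |S r e| + ∑ _e : E, M), fun q e => abs_le.2
    ⟨(neg_le_neg (le_max_right _ _)).trans (h_lower q e), (h_upper q e).trans (le_max_left _ _)⟩⟩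

end StrictlyProper

end ScoringRule

section Posterior

variable {Ω E : Type*} {m m' mΩ : MeasurableSpace Ω} {μ : Measure Ω} {out : Ω → E}

theorem posterior_nonneg (e : E) : 0 ≤ᵐ[μ] posterior μ out m e :=
  condExp_nonneg (.of_forall (Set.indicator_nonneg fun _ _ => zero_le_one))

variable [MeasurableSpace E] [MeasurableSingletonClass E]

theorem integrable_indicator_outcome [IsFiniteMeasure μ] (hout : Measurable out) (e : E) :
    Integrable ((out ⁻¹' {e}).indicator fun _ => (1 : ℝ)) μ :=
  (integrable_const 1).indicator (hout (measurableSet_singleton e))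

theorem Reveals.posterior_ae_eq [IsFiniteMeasure μ] (hout : Measurable out)
    (hr : Reveals μ m' m) (hle : m' ≤ m) (hm : m ≤ mΩ) (e : E) :
    posterior μ out m' e =ᵐ[μ] posterior μ out m e :=
  hr.condExp_ae_eq hle hm (integrable_indicator_outcome hout e)

theorem posterior_comp_of_measurePreserving {Ω' : Type*} [MeasurableSpace Ω']
    {μ' : Measure Ω'} [IsFiniteMeasure μ] [IsFiniteMeasure μ'] {ψ : Ω' → Ω}
    (hψ : MeasurePreserving ψ μ' μ) (hout : Measurable out) (hm : m ≤ mΩ) (e : E) :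
    posterior μ' (out ∘ ψ) (m.comap ψ) e =ᵐ[μ'] posterior μ out m e ∘ ψ :=
  condExp_comp_of_measurePreserving (g := (out ⁻¹' {e}).indicator fun _ => 1) hψ
    (integrable_indicator_outcome hout e) hm

theorem posterior_prod_fst {β : Type*} {mβ : MeasurableSpace β} {ν : Measure β}
    [IsFiniteMeasure μ] [IsProbabilityMeasure ν] (hout : Measurable out) (hm : m ≤ mΩ) (e : E) :
    posterior (μ.prod ν) (fun ω => out ω.1) (m.prod mβ) e =ᵐ[μ.prod ν]
      posterior μ out m e ∘ Prod.fst :=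
  condExp_prod_fst (g := (out ⁻¹' {e}).indicator fun _ => 1)
    (integrable_indicator_outcome hout e) hm

theorem integrable_apply_outcome_iff [Finite E] [IsFiniteMeasure μ] (hout : Measurable out)
    (hm : m ≤ mΩ) {F : Ω → E → ℝ} (hF : ∀ e, Measurable[m] (F · e)) :
    Integrable (fun ω => F ω (out ω)) μ ↔
      ∀ e, Integrable (fun ω => posterior μ out m e ω * F ω e) μ := by
  classical
  have := Fintype.ofFinite E
  simp only [posterior, integrable_condExp_mul_iff hm (integrable_indicator_outcome hout _)
    (.of_forall (Set.indicator_nonneg fun _ _ => zero_le_one)) (hF _)]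
  refine ⟨fun h e => ?_, fun h => ?_⟩
  · refine (h.indicator (hout (measurableSet_singleton e))).congr (.of_forall fun ω => ?_)
    by_cases hω : out ω = e <;> simp [hω]
  · refine (integrable_finsetSum Finset.univ fun e _ => h e).congr (.of_forall fun ω => ?_)
    simp [Set.indicator_apply]

variable [Fintype E]

theorem posterior_mem_stdSimplex [IsProbabilityMeasure μ] (hout : Measurable out) (hm : m ≤ mΩ) :
    ∀ᵐ ω ∂μ, (posterior μ out m · ω) ∈ stdSimplex ℝ E := by
  classical
  have h_sum : ∑ e, posterior μ out m e =ᵐ[μ] fun _ => 1 := by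
    refine (condExp_finsetSum (fun e _ => integrable_indicator_outcome hout e) m).symm.trans ?_
    have h_indicator : ∑ e, (out ⁻¹' {e}).indicator (fun _ => (1 : ℝ)) = fun _ => 1 := by
      ext ω
      simp [Finset.sum_apply, Set.indicator_apply]
    rw [h_indicator, condExp_const hm]
  filter_upwards [ae_all_iff.2 (posterior_nonneg (μ := μ) (out := out) (m := m)), h_sum]
    with ω h_nonneg h_sum
  exact ⟨h_nonneg, by simpa using h_sum⟩

/-- The random prediction `X` is a version of the posterior distribution of the outcome given the
signal `m`. -/
def IsPosterior (μ : Measure Ω) (out : Ω → E) (m : MeasurableSpace Ω) (X : Ω → Prediction E) :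
    Prop :=
  ∀ᵐ ω ∂μ, ∀ e, (X ω).1 e = posterior μ out m e ω

theorem exists_isPosterior [IsProbabilityMeasure μ] (hout : Measurable out) (hm : m ≤ mΩ) :
    ∃ X : Ω → Prediction E, Measurable[m] X ∧ IsPosterior μ out m X := by
  classical
  have h_mem := posterior_mem_stdSimplex (E := E) (μ := μ) hout hm
  obtain ⟨ω₀, hω₀⟩ := h_mem.exists
  have h_meas : Measurable[m] fun ω => (posterior μ out m · ω) :=
    @measurable_pi_lambda _ _ _ m _ _ fun e => stronglyMeasurable_condExp.measurable
  have h_set : MeasurableSet[m] {ω | (posterior μ out m · ω) ∈ stdSimplex ℝ E} :=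
    h_meas (isClosed_stdSimplex ℝ E).measurableSet
  let X (ω : Ω) : E → ℝ :=
    if (posterior μ out m · ω) ∈ stdSimplex ℝ E then (posterior μ out m · ω)
    else (posterior μ out m · ω₀)
  have hX (ω : Ω) : X ω ∈ stdSimplex ℝ E := by
    by_cases hω : (posterior μ out m · ω) ∈ stdSimplex ℝ E <;> simp [X, hω, hω₀]
  refine ⟨fun ω => ⟨X ω, hX ω⟩,
    (Measurable.ite h_set h_meas measurable_const).subtype_mk (h := hX), ?_⟩
  filter_upwards [h_mem] with ω hω e
  simp [X, hω]

theorem integral_apply_outcome_eq [IsFiniteMeasure μ] (hout : Measurable out) (hm : m ≤ mΩ)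
    {F : Ω → E → ℝ} (hF : ∀ e, Measurable[m] (F · e))
    (h_int : Integrable (fun ω => F ω (out ω)) μ) :
    ∫ ω, F ω (out ω) ∂μ = ∫ ω, ∑ e, posterior μ out m e ω * F ω e ∂μ := by
  classical
  have h_posterior := (integrable_apply_outcome_iff hout hm hF).1 h_int
  have h_indicator (e : E) :
      Integrable (fun ω => (out ⁻¹' {e}).indicator (fun _ => 1) ω * F ω e) μ :=
    (integrable_condExp_mul_iff hm (integrable_indicator_outcome hout e)
      (.of_forall (Set.indicator_nonneg fun _ _ => zero_le_one)) (hF e)).1 (h_posterior e)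
  calc ∫ ω, F ω (out ω) ∂μ
      = ∫ ω, ∑ e, (out ⁻¹' {e}).indicator (fun _ => 1) ω * F ω e ∂μ := by
        simp [Set.indicator_apply]
    _ = ∑ e, ∫ ω, (out ⁻¹' {e}).indicator (fun _ => 1) ω * F ω e ∂μ :=
        integral_finsetSum _ fun e _ => h_indicator e
    _ = ∑ e, ∫ ω, posterior μ out m e ω * F ω e ∂μ := Finset.sum_congr rfl fun e _ =>
        (integral_condExp_mul hm (integrable_indicator_outcome hout e) (hF e) (h_indicator e)).symm
    _ = ∫ ω, ∑ e, posterior μ out m e ω * F ω e ∂μ :=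
        (integral_finsetSum _ fun e _ => h_posterior e).symm

end Posterior

section SignalValue

variable {Ω E : Type*} {m m' mΩ : MeasurableSpace Ω} {μ : Measure Ω} [Fintype E] {out : Ω → E}
  {S : Prediction E → E → ℝ} {X : Ω → Prediction E}

theorem IsPosterior.sum_mul_score_eq_iSup (hX : IsPosterior μ out m X) (hS : StrictlyProper S) :
    ∀ᵐ ω ∂μ, ∑ e, posterior μ out m e ω * S (X ω) e =
      ⨆ r : Prediction E, ∑ e, posterior μ out m e ω * S r e := by
  filter_upwards [hX] with ω hω
  simpa only [hω] using (hS.iSup_eq (X ω)).symm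

variable [MeasurableSpace E] [MeasurableSingletonClass E]

theorem integral_score_eq [IsFiniteMeasure μ] (hSm : ∀ e, Measurable (S · e))
    (hout : Measurable out) (hm : m ≤ mΩ) (hXm : Measurable[m] X)
    (h_int : Integrable (fun ω => S (X ω) (out ω)) μ) :
    ∫ ω, S (X ω) (out ω) ∂μ = ∫ ω, ∑ e, posterior μ out m e ω * S (X ω) e ∂μ :=
  integral_apply_outcome_eq (F := fun ω => S (X ω)) hout hm (fun e => (hSm e).comp hXm) h_int

theorem integrable_sum_posterior_mul_score [IsFiniteMeasure μ] (hSm : ∀ e, Measurable (S · e))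
    (hout : Measurable out) (hm : m ≤ mΩ) (hXm : Measurable[m] X)
    (h_int : Integrable (fun ω => S (X ω) (out ω)) μ) :
    Integrable (fun ω => ∑ e, posterior μ out m e ω * S (X ω) e) μ :=
  integrable_finsetSum _ fun e _ => (integrable_apply_outcome_iff (F := fun ω => S (X ω)) hout hm
    fun e => (hSm e).comp hXm).1 h_int e

variable [IsProbabilityMeasure μ]

theorem IsPosterior.integrable_score (hX : IsPosterior μ out m X) (hXm : Measurable[m] X)
    (hm : m ≤ mΩ) (hout : Measurable out) (hS : StrictlyProper S)
    (hSm : ∀ e, Measurable (S · e)) : Integrable (fun ω => S (X ω) (out ω)) μ := by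
  obtain ⟨C, hC⟩ := hS.exists_abs_mul_score_le
  refine (integrable_apply_outcome_iff hout hm fun e => (hSm e).comp hXm).2 fun e => ?_
  refine .of_bound (integrable_condExp.1.mul
    (((hSm e).comp hXm).mono hm le_rfl).aestronglyMeasurable) C ?_
  filter_upwards [hX] with ω hω
  simpa [← hω e] using hC (X ω) e

theorem IsPosterior.integral_score (hX : IsPosterior μ out m X) (hXm : Measurable[m] X)
    (hm : m ≤ mΩ) (hout : Measurable out) (hS : StrictlyProper S)
    (hSm : ∀ e, Measurable (S · e)) : ∫ ω, S (X ω) (out ω) ∂μ = signalValue μ out S m :=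
  (integral_score_eq hSm hout hm hXm (hX.integrable_score hXm hm hout hS hSm)).trans
    (integral_congr_ae (hX.sum_mul_score_eq_iSup hS))

theorem integral_score_le_signalValue (hS : StrictlyProper S) (hSm : ∀ e, Measurable (S · e))
    (hout : Measurable out) (hm : m ≤ mΩ) (hXm : Measurable[m] X)
    (hX : Integrable (fun ω => S (X ω) (out ω)) μ) :
    ∫ ω, S (X ω) (out ω) ∂μ ≤ signalValue μ out S m := by
  obtain ⟨Y, hYm, hY⟩ := exists_isPosterior (μ := μ) hout hm
  have hY_int := hY.integrable_score hYm hm hout hS hSm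
  rw [← hY.integral_score hYm hm hout hS hSm, integral_score_eq hSm hout hm hXm hX,
    integral_score_eq hSm hout hm hYm hY_int]
  refine integral_mono_ae (integrable_sum_posterior_mul_score hSm hout hm hXm hX)
    (integrable_sum_posterior_mul_score hSm hout hm hYm hY_int) ?_
  filter_upwards [hY] with ω hω
  simpa only [← hω] using hS.le (Y ω) (X ω)

theorem isPosterior_of_signalValue_le (hS : StrictlyProper S) (hSm : ∀ e, Measurable (S · e))
    (hout : Measurable out) (hm : m ≤ mΩ) (hXm : Measurable[m] X)
    (hX : Integrable (fun ω => S (X ω) (out ω)) μ)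
    (hV : signalValue μ out S m ≤ ∫ ω, S (X ω) (out ω) ∂μ) : IsPosterior μ out m X := by
  obtain ⟨Y, hYm, hY⟩ := exists_isPosterior (μ := μ) hout hm
  have hY_int := hY.integrable_score hYm hm hout hS hSm
  have h_le : (fun ω => ∑ e, posterior μ out m e ω * S (X ω) e) ≤ᵐ[μ]
      fun ω => ∑ e, posterior μ out m e ω * S (Y ω) e := by
    filter_upwards [hY] with ω hω
    simpa only [← hω] using hS.le (Y ω) (X ω)
  have h_eq := (integral_eq_iff_of_ae_le (integrable_sum_posterior_mul_score hSm hout hm hXm hX)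
    (integrable_sum_posterior_mul_score hSm hout hm hYm hY_int) h_le).1 <| by
      rw [← integral_score_eq hSm hout hm hXm hX, ← integral_score_eq hSm hout hm hYm hY_int,
        hY.integral_score hYm hm hout hS hSm]
      exact (integral_score_le_signalValue hS hSm hout hm hXm hX).antisymm hV
  filter_upwards [h_eq, hY] with ω h_eq hω
  simp only [← hω] at h_eq ⊢
  have h_same : X ω = Y ω := by_contra fun h_ne => (hS (Y ω) (X ω) h_ne).ne h_eq
  simp [h_same]

theorem signalValue_mono (hS : StrictlyProper S) (hSm : ∀ e, Measurable (S · e))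
    (hout : Measurable out) (hle : m' ≤ m) (hm : m ≤ mΩ) :
    signalValue μ out S m' ≤ signalValue μ out S m := by
  obtain ⟨X, hXm, hX⟩ := exists_isPosterior (μ := μ) hout (hle.trans hm)
  rw [← hX.integral_score hXm (hle.trans hm) hout hS hSm]
  exact integral_score_le_signalValue hS hSm hout hm (hXm.mono hle le_rfl)
    (hX.integrable_score hXm (hle.trans hm) hout hS hSm)

theorem posterior_ae_eq_of_signalValue_le (hS : StrictlyProper S) (hSm : ∀ e, Measurable (S · e))
    (hout : Measurable out) (hle : m' ≤ m) (hm : m ≤ mΩ)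
    (hV : signalValue μ out S m ≤ signalValue μ out S m') (e : E) :
    posterior μ out m' e =ᵐ[μ] posterior μ out m e := by
  obtain ⟨X, hXm, hX⟩ := exists_isPosterior (μ := μ) hout (hle.trans hm)
  rw [← hX.integral_score hXm (hle.trans hm) hout hS hSm] at hV
  filter_upwards [hX, isPosterior_of_signalValue_le hS hSm hout hm (hXm.mono hle le_rfl)
    (hX.integrable_score hXm (hle.trans hm) hout hS hSm) hV] with ω h h'
  rw [← h, h']

theorem signalValue_le_of_reveals (hS : StrictlyProper S) (hSm : ∀ e, Measurable (S · e))
    (hout : Measurable out) (hm' : m' ≤ mΩ) (hm : m ≤ mΩ) (hr : Reveals μ m' m) :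
    signalValue μ out S m ≤ signalValue μ out S m' := by
  refine (signalValue_mono hS hSm hout le_sup_right (sup_le hm' hm)).trans_eq
    (integral_congr_ae ?_)
  filter_upwards [ae_all_iff.2
    (hr.sup_left.posterior_ae_eq hout le_sup_left (sup_le hm' hm))] with ω hω
  simp only [hω]

section Transport

variable {Ω' : Type*} {n mΩ' : MeasurableSpace Ω'} {μ' : Measure Ω'} [IsProbabilityMeasure μ']
  {ψ : Ω' → Ω}

theorem signalValue_eq_of_posterior_comp (hS : StrictlyProper S) (hSm : ∀ e, Measurable (S · e))
    (hout : Measurable out) (hψ : MeasurePreserving ψ μ' μ) (hm : m ≤ mΩ) (hn : n ≤ mΩ')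
    (hψm : Measurable[n, m] ψ)
    (h : ∀ e, posterior μ' (out ∘ ψ) n e =ᵐ[μ'] posterior μ out m e ∘ ψ) :
    signalValue μ' (out ∘ ψ) S n = signalValue μ out S m := by
  obtain ⟨X, hXm, hX⟩ := exists_isPosterior (μ := μ) hout hm
  have hXψ : IsPosterior μ' (out ∘ ψ) n (X ∘ ψ) := by
    filter_upwards [ae_all_iff.2 h, hψ.quasiMeasurePreserving.ae hX] with ω h_comp hω e
    rw [h_comp]
    exact hω e
  rw [← hX.integral_score hXm hm hout hS hSm,
    ← hXψ.integral_score (hXm.comp hψm) hn (hout.comp hψ.measurable) hS hSm, ← hψ.map_eq,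
    integral_map hψ.aemeasurable]
  · rfl
  · rw [hψ.map_eq]
    exact (hX.integrable_score hXm hm hout hS hSm).1

theorem signalValue_comap (hS : StrictlyProper S) (hSm : ∀ e, Measurable (S · e))
    (hout : Measurable out) (hψ : MeasurePreserving ψ μ' μ) (hm : m ≤ mΩ) :
    signalValue μ' (out ∘ ψ) S (m.comap ψ) = signalValue μ out S m :=
  signalValue_eq_of_posterior_comp hS hSm hout hψ hm
    ((MeasurableSpace.comap_mono hm).trans hψ.measurable.comap_le) (comap_measurable ψ)
    (posterior_comp_of_measurePreserving hψ hout hm)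

end Transport

theorem signalValue_prod_fst {β : Type*} {mβ : MeasurableSpace β} {ν : Measure β}
    [IsProbabilityMeasure ν] (hS : StrictlyProper S) (hSm : ∀ e, Measurable (S · e))
    (hout : Measurable out) (hm : m ≤ mΩ) :
    signalValue (μ.prod ν) (fun ω => out ω.1) S (m.prod mβ) = signalValue μ out S m :=
  signalValue_eq_of_posterior_comp (ψ := Prod.fst) hS hSm hout measurePreserving_fst hm
    (sup_le_sup (MeasurableSpace.comap_mono hm) le_rfl) (@measurable_fst _ _ m mβ)
    (posterior_prod_fst hout hm)

end SignalValue

section BaseSignal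

variable {I : Type*} {A : I → Type*} {E : Type*} [∀ s, MeasurableSpace (A s)]

/-- The signal `A_O` as a signal on the sample space of the prior, without any seed. -/
abbrev baseSignal (O : Finset I) : MeasurableSpace ((∀ s, A s) × E) :=
  MeasurableSpace.comap (fun ω (s : O) => ω.1 s) inferInstance

theorem baseSignal_eq_iSup (O : Finset I) :
    (baseSignal O : MeasurableSpace ((∀ s, A s) × E)) =
      ⨆ s ∈ O, MeasurableSpace.comap (fun ω : (∀ s, A s) × E => ω.1 s) inferInstance := by
  rw [baseSignal, iSup_subtype', show (inferInstance : MeasurableSpace (∀ s : O, A s)) =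
    MeasurableSpace.pi from rfl, MeasurableSpace.pi, MeasurableSpace.comap_iSup]
  simp only [MeasurableSpace.comap_comp]
  rfl

theorem baseSignal_empty : (baseSignal ∅ : MeasurableSpace ((∀ s, A s) × E)) = ⊥ := by
  simp [baseSignal_eq_iSup]

theorem baseSignal_mono {O O' : Finset I} (h : O ⊆ O') :
    (baseSignal O : MeasurableSpace ((∀ s, A s) × E)) ≤ baseSignal O' := by
  rw [baseSignal_eq_iSup, baseSignal_eq_iSup]
  exact biSup_mono fun _ hs => h hs

theorem baseSignal_sup [DecidableEq I] (O T : Finset I) :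
    (baseSignal O ⊔ baseSignal T : MeasurableSpace ((∀ s, A s) × E)) = baseSignal (O ∪ T) := by
  simp only [baseSignal_eq_iSup, Finset.mem_union, iSup_or, iSup_sup_eq]

theorem subsetSignal_eq_comap_baseSignal (O : Finset I) :
    (subsetSignal O : MeasurableSpace (((∀ s, A s) × E) × unitInterval)) =
      (baseSignal O).comap Prod.fst := by
  rw [MeasurableSpace.comap_comp]
  rfl

theorem subsetSignal_sup [DecidableEq I] (O T : Finset I) :
    (subsetSignal O ⊔ subsetSignal T : MeasurableSpace (((∀ s, A s) × E) × unitInterval)) =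
      subsetSignal (O ∪ T) := by
  simp only [subsetSignal_eq_comap_baseSignal, ← MeasurableSpace.comap_sup, baseSignal_sup]

theorem seededSubsetSignal_eq_prod (O : Finset I) :
    (seededSubsetSignal O : MeasurableSpace (((∀ s, A s) × E) × unitInterval)) =
      (baseSignal O).prod inferInstance := by
  rw [MeasurableSpace.prod, ← subsetSignal_eq_comap_baseSignal]
  exact MeasurableSpace.comap_prodMk _ _

variable [MeasurableSpace E]

theorem baseSignal_le (O : Finset I) :
    (baseSignal O : MeasurableSpace ((∀ s, A s) × E)) ≤ Prod.instMeasurableSpace :=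
  (measurable_pi_lambda _ fun _ => (measurable_pi_apply _).comp measurable_fst).comap_le

variable {β : Type*} {mβ : MeasurableSpace β}

theorem comap_fst_baseSignal_le (O : Finset I) :
    ((baseSignal O).comap Prod.fst : MeasurableSpace (((∀ s, A s) × E) × β)) ≤
      Prod.instMeasurableSpace :=
  (MeasurableSpace.comap_mono (baseSignal_le O)).trans measurable_fst.comap_le

theorem prod_baseSignal_le (O : Finset I) :
    ((baseSignal O).prod mβ : MeasurableSpace (((∀ s, A s) × E) × β)) ≤
      Prod.instMeasurableSpace :=
  sup_le_sup (MeasurableSpace.comap_mono (baseSignal_le O)) le_rfl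

theorem measurable_outcome : Measurable fun ω : ((∀ s, A s) × E) × β => ω.1.2 :=
  measurable_snd.comp measurable_fst

end BaseSignal

section SubstituteValues

/-- The sample space of the market: base signals, outcome and private seeds. -/
abbrev MarketSpace {I : Type*} (A : I → Type*) (E J : Type*) : Type _ :=
  ((∀ s, A s) × E) × (J → unitInterval)

variable {I : Type*} {A : I → Type*} {E : Type*} {J : Type*} [∀ s, MeasurableSpace (A s)]
  [Fintype E] [MeasurableSpace E] [Fintype J] {P : Measure ((∀ s, A s) × E)}
  {S : Prediction E → E → ℝ}

/-- The value `V(A_O)` of the base signals in `O`. -/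
noncomputable def baseValue (P : Measure ((∀ s, A s) × E)) (S : Prediction E → E → ℝ)
    (O : Finset I) : ℝ :=
  signalValue P Prod.snd S (baseSignal O)

/-- The value of a signal that may depend on a single uniform seed. -/
noncomputable def seededValue (P : Measure ((∀ s, A s) × E)) (S : Prediction E → E → ℝ)
    (m : MeasurableSpace (((∀ s, A s) × E) × unitInterval)) : ℝ :=
  signalValue (seededPrior P) (fun ω => ω.1.2) S m

/-- The value of a signal that may depend on the seeds of all traders. -/
noncomputable def marketValue (P : Measure ((∀ s, A s) × E)) (S : Prediction E → E → ℝ)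
    (m : MeasurableSpace (MarketSpace A E J)) : ℝ :=
  signalValue (marketMeasure P) (fun ω => ω.1.2) S m

variable [IsProbabilityMeasure P]

instance : IsProbabilityMeasure (seededPrior P) := by
  unfold seededPrior
  infer_instance

instance : IsProbabilityMeasure (marketMeasure (J := J) P) := by
  unfold marketMeasure
  infer_instance

variable [MeasurableSingletonClass E] (hS : StrictlyProper S) (hSm : ∀ e, Measurable (S · e))
include hS hSm

theorem seededValue_subsetSignal (O : Finset I) :
    seededValue P S (subsetSignal O) = baseValue P S O := by
  rw [subsetSignal_eq_comap_baseSignal]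
  exact signalValue_comap hS hSm measurable_snd measurePreserving_fst (baseSignal_le O)

theorem marketValue_mono {m m' : MeasurableSpace (MarketSpace A E J)} (hle : m' ≤ m)
    (hm : m ≤ Prod.instMeasurableSpace) : marketValue P S m' ≤ marketValue P S m :=
  signalValue_mono hS hSm measurable_outcome hle hm

theorem marketValue_comap_baseSignal (O : Finset I) :
    marketValue P S ((baseSignal O).comap Prod.fst : MeasurableSpace (MarketSpace A E J)) =
      baseValue P S O :=
  signalValue_comap hS hSm measurable_snd measurePreserving_fst (baseSignal_le O)

theorem marketValue_prod_baseSignal (O : Finset I) :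
    marketValue P S ((baseSignal O).prod (inferInstance : MeasurableSpace (J → unitInterval))) =
      baseValue P S O :=
  signalValue_prod_fst hS hSm measurable_snd (baseSignal_le O)

/-- One uniform seed simulates the seeds of all traders. -/
theorem exists_seeded_of_le_prod_baseSignal (O : Finset I) :
    ∀ m ≤ (baseSignal O).prod (inferInstance : MeasurableSpace (J → unitInterval)),
      ∃ m' ≤ seededSubsetSignal O, seededValue P S m' = marketValue P S m ∧
        ∀ T, seededValue P S (m' ⊔ subsetSignal T) =
          marketValue P S (m ⊔ (baseSignal T).comap Prod.fst) := by
  obtain ⟨φ, hφ, hmap⟩ := Measure.exists_measurable_map_eq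
    (Measure.pi fun _ : J => (volume : Measure unitInterval))
  let ψ : ((∀ s, A s) × E) × unitInterval → MarketSpace A E J := Prod.map id φ
  have hψ : MeasurePreserving ψ (seededPrior P) (marketMeasure P) :=
    (MeasurePreserving.id P).prod ⟨hφ, hmap⟩
  have h_comap : ∀ n : MeasurableSpace (MarketSpace A E J), n ≤ Prod.instMeasurableSpace →
      seededValue P S (n.comap ψ) = marketValue P S n :=
    fun _ => signalValue_comap (out := fun ω : MarketSpace A E J => ω.1.2) hS hSm
      measurable_outcome hψ
  have hψ_base : Measurable[(baseSignal O).prod _, (baseSignal O).prod _] ψ :=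
    (@measurable_fst _ _ (baseSignal O) _).prodMk
      (hφ.comp (@measurable_snd _ _ (baseSignal O) _))
  have hψ_fst (T : Finset I) : ((baseSignal T).comap Prod.fst).comap ψ = subsetSignal T := by
    rw [MeasurableSpace.comap_comp, subsetSignal_eq_comap_baseSignal]
    rfl
  intro m hm
  have hm_le := hm.trans (prod_baseSignal_le O)
  refine ⟨m.comap ψ, ?_, h_comap m hm_le, fun T => ?_⟩
  · rw [seededSubsetSignal_eq_prod]
    exact (MeasurableSpace.comap_mono hm).trans hψ_base.comap_le
  · rw [← h_comap _ (sup_le hm_le (comap_fst_baseSignal_le T)), MeasurableSpace.comap_sup, hψ_fst]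

namespace StrictStrongSubstitutes

variable [DecidableEq I] (hsubs : StrictStrongSubstitutes P S) {O T : Finset I}
  {m : MeasurableSpace (MarketSpace A E J)} (hm : m ≤ (baseSignal O).prod inferInstance)
include hsubs hm

theorem baseValue_union_sub_le :
    baseValue P S (O ∪ T) - baseValue P S O ≤
      marketValue P S (m ⊔ (baseSignal T).comap Prod.fst) - marketValue P S m := by
  obtain ⟨m', hm', h_value, h_sup⟩ := exists_seeded_of_le_prod_baseSignal (P := P) hS hSm O m hm
  simp only [← seededValue_subsetSignal hS hSm, ← subsetSignal_sup, ← h_value, ← h_sup]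
  exact (hsubs O T m' hm').1

theorem baseValue_le_marketValue (hTO : ¬ T ⊆ O)
    (hle : marketValue P S (m ⊔ (baseSignal T).comap Prod.fst) - marketValue P S m ≤
      baseValue P S (O ∪ T) - baseValue P S O) :
    baseValue P S O ≤ marketValue P S m := by
  by_cases hOT : O ⊆ T
  · have h_mono : baseValue P S T ≤ marketValue P S (m ⊔ (baseSignal T).comap Prod.fst) := by
      rw [← marketValue_comap_baseSignal (J := J) hS hSm]
      exact marketValue_mono hS hSm le_sup_right
        (sup_le (hm.trans (prod_baseSignal_le O)) (comap_fst_baseSignal_le T))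
    rw [Finset.union_eq_right.2 hOT] at hle
    linarith
  · obtain ⟨m', hm', h_value, h_sup⟩ := exists_seeded_of_le_prod_baseSignal (P := P) hS hSm O m hm
    simp only [← seededValue_subsetSignal hS hSm, ← subsetSignal_sup, ← h_value, ← h_sup] at hle ⊢
    have h_reveals : Reveals (seededPrior P) m' (subsetSignal O) :=
      by_contra fun h_not => ((hsubs O T m' hm').2 hOT hTO h_not).not_ge hle
    refine signalValue_le_of_reveals hS hSm measurable_outcome ?_ ?_ h_reveals
    · exact hm'.trans ((seededSubsetSignal_eq_prod O).trans_le (prod_baseSignal_le O))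
    · exact (subsetSignal_eq_comap_baseSignal O).trans_le (comap_fst_baseSignal_le O)

end StrictStrongSubstitutes

end SubstituteValues

section Play

variable {I : Type*} {A : I → Type*} {E : Type*} {J : Type*}
  [∀ s, MeasurableSpace (A s)] [Fintype E] {p₀ : Prediction E} {obs : J → Finset I}
  {order : ℕ → J} {σ : (j : J) → Strategy A E (obs j)} {t : ℕ}

theorem history_castSucc (ω : MarketSpace A E J) (i : Fin (t + 1)) :
    history p₀ order σ (t + 1) ω i.castSucc = history p₀ order σ t ω i := by
  simp [history]

theorem price_succ (ω : MarketSpace A E J) :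
    price p₀ order σ (t + 1) ω = (σ (order t)).act t (fun s => ω.1.1 s) (ω.2 (order t))
      (history p₀ order σ t ω) := by
  simp [price, history]

theorem measurable_history_succ_of_measurable {m : MeasurableSpace (MarketSpace A E J)}
    (h_signal : Measurable[m] fun ω => fun s : obs (order t) => ω.1.1 s)
    (h_seed : Measurable[m] fun ω => ω.2 (order t))
    (h_history : Measurable[m] (history p₀ order σ t)) :
    Measurable[m] (history p₀ order σ (t + 1)) := by
  refine @measurable_pi_lambda _ _ _ m _ _ fun i => ?_
  induction i using Fin.lastCases with
  | last =>
    simp only [history, Fin.snoc_last]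
    exact ((σ (order t)).measurable_act t).comp (h_signal.prodMk (h_seed.prodMk h_history))
  | cast i =>
    simp only [history_castSucc]
    exact (measurable_pi_apply i).comp h_history

/-- The base signals observed by the traders who trade before step `t`. -/
def pooledObs [DecidableEq I] (obs : J → Finset I) (order : ℕ → J) (t : ℕ) : Finset I :=
  (Finset.range t).biUnion fun s => obs (order s)

theorem subset_pooledObs [DecidableEq I] {s : ℕ} (hst : s < t) :
    obs (order s) ⊆ pooledObs obs order t :=
  Finset.subset_biUnion_of_mem (fun s => obs (order s)) (Finset.mem_range.2 hst)

theorem pooledObs_succ [DecidableEq I] :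
    pooledObs obs order (t + 1) = pooledObs obs order t ∪ obs (order t) := by
  rw [pooledObs, Finset.range_add_one, Finset.biUnion_insert, Finset.union_comm, ← pooledObs]

theorem measurable_history_prod_baseSignal {O : Finset I} (hO : ∀ s < t, obs (order s) ⊆ O) :
    Measurable[(baseSignal O).prod inferInstance] (history p₀ order σ t) := by
  induction t with
  | zero => exact measurable_const
  | succ t ih =>
    refine measurable_history_succ_of_measurable (measurable_iff_comap_le.2 ?_)
      ((measurable_pi_apply _).comp (@measurable_snd _ _ (baseSignal O) _))
      (ih fun s hs => hO s (hs.trans t.lt_succ_self))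
    refine le_trans (le_of_eq ?_) (le_sup_of_le_left
      (MeasurableSpace.comap_mono (baseSignal_mono (hO t t.lt_succ_self))))
    rw [MeasurableSpace.comap_comp]
    rfl

/-- The public information at step `t`: the predictions `p⁽⁰⁾, …, p⁽ᵗ⁾`. -/
abbrev historySignal (p₀ : Prediction E) {obs : J → Finset I} (order : ℕ → J)
    (σ : (j : J) → Strategy A E (obs j)) (t : ℕ) : MeasurableSpace (MarketSpace A E J) :=
  MeasurableSpace.comap (history p₀ order σ t) inferInstance

theorem historySignal_mono : Monotone (historySignal p₀ order σ) := by
  refine monotone_nat_of_le_succ fun t => Measurable.comap_le ?_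
  refine @measurable_pi_lambda _ _ _ (_) _ _ fun i => ?_
  simpa only [Function.comp_def, history_castSucc] using
    (measurable_pi_apply i.castSucc).comp (comap_measurable (history p₀ order σ (t + 1)))

theorem measurable_price : Measurable[historySignal p₀ order σ t] (price p₀ order σ t) :=
  (measurable_pi_apply (Fin.last t)).comp (comap_measurable _)

theorem historySignal_le_prod_pooledObs [DecidableEq I] :
    historySignal p₀ order σ t ≤ (baseSignal (pooledObs obs order t)).prod inferInstance :=
  (measurable_history_prod_baseSignal fun _ => subset_pooledObs).comap_le

theorem historySignal_le [MeasurableSpace E] :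
    historySignal p₀ order σ t ≤ Prod.instMeasurableSpace := by
  classical exact historySignal_le_prod_pooledObs.trans (prod_baseSignal_le _)

theorem traderInfo_eq_sup : traderInfo p₀ order σ t =
    historySignal p₀ order σ t ⊔ (baseSignal (obs (order t))).comap Prod.fst := by
  rw [sup_comm, MeasurableSpace.comap_comp]
  exact MeasurableSpace.comap_prodMk _ _

theorem historySignal_le_traderInfo : historySignal p₀ order σ t ≤ traderInfo p₀ order σ t :=
  traderInfo_eq_sup.ge.trans' le_sup_left

theorem traderInfo_le_prod_pooledObs [DecidableEq I] : traderInfo p₀ order σ t ≤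
    (baseSignal (pooledObs obs order (t + 1))).prod inferInstance := by
  rw [traderInfo_eq_sup]
  exact sup_le (historySignal_mono t.le_succ |>.trans historySignal_le_prod_pooledObs)
    (le_sup_of_le_left (MeasurableSpace.comap_mono (baseSignal_mono
      (subset_pooledObs t.lt_succ_self))))

theorem traderInfo_le [MeasurableSpace E] : traderInfo p₀ order σ t ≤ Prod.instMeasurableSpace :=
  traderInfo_eq_sup.trans_le (sup_le historySignal_le (comap_fst_baseSignal_le _))

theorem traderInfo_mono {s : ℕ} (hst : s ≤ t) (h : order s = order t) :
    traderInfo p₀ order σ s ≤ traderInfo p₀ order σ t := by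
  rw [traderInfo_eq_sup, traderInfo_eq_sup, h]
  exact sup_le_sup_right (historySignal_mono hst) _

/-- The strategy that follows `τ` before step `t`, reports `f` at step `t` as a function of the
trader's signal and the predictions so far, and leaves the prediction unchanged afterwards. -/
def Strategy.reportThenStop {O : Finset I} (τ : Strategy A E O) (t : ℕ)
    (f : ((s : O) → A s) × (Fin (t + 1) → Prediction E) → Prediction E) (hf : Measurable f) :
    Strategy A E O where
  act s x u p :=
    if s < t then τ.act s x u p
    else if h : s = t then f (x, fun i => p (i.cast (by rw [h])))
    else p (Fin.last s)
  measurable_act s := by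
    rcases lt_trichotomy s t with h | rfl | h
    · simpa only [h, if_true] using τ.measurable_act s
    · simp only [lt_irrefl, if_false, dite_true]
      exact hf.comp (measurable_fst.prodMk (measurable_snd.comp measurable_snd))
    · simp only [h.not_gt, h.ne', if_false, dite_false]
      exact (measurable_pi_apply _).comp (measurable_snd.comp measurable_snd)

variable [DecidableEq J]

theorem history_update {j : J} {τ : Strategy A E (obs j)}
    (h : ∀ s < t, order s = j → τ.act s = (σ j).act s) :
    history p₀ order (Function.update σ j τ) t = history p₀ order σ t := by
  induction t with
  | zero => rfl
  | succ t ih =>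
    have h_act : (Function.update σ j τ (order t)).act t = (σ (order t)).act t := by
      rcases eq_or_ne (order t) j with rfl | hj
      · rw [Function.update_self, h t t.lt_succ_self rfl]
      · rw [Function.update_of_ne hj]
    ext ω : 1
    simp only [history, ih fun s hs => h s (hs.trans t.lt_succ_self), h_act]

theorem payoff_succ (S : Prediction E → E → ℝ) (j : J) (ω : MarketSpace A E J) :
    payoff S p₀ order (t + 1) σ j ω = payoff S p₀ order t σ j ω +
      if order t = j then S (price p₀ order σ (t + 1) ω) ω.1.2 - S (price p₀ order σ t ω) ω.1.2
      else 0 := by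
  simp only [payoff, Finset.sum_filter, Finset.sum_range_succ]

theorem payoff_reportThenStop (S : Prediction E → E → ℝ) {N : ℕ} (ht : t < N)
    {f : ((s : obs (order t)) → A s) × (Fin (t + 1) → Prediction E) → Prediction E}
    (hf : Measurable f) (ω : MarketSpace A E J) :
    payoff S p₀ order N
        (Function.update σ (order t) ((σ (order t)).reportThenStop t f hf)) (order t) ω =
      payoff S p₀ order t σ (order t) ω +
        (S (f (fun s => ω.1.1 s, history p₀ order σ t ω)) ω.1.2 -
          S (price p₀ order σ t ω) ω.1.2) := by
  set τ := (σ (order t)).reportThenStop t f hf with hτ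
  have h_history {s : ℕ} (hs : s ≤ t) :
      history p₀ order (Function.update σ (order t) τ) s = history p₀ order σ s :=
    history_update fun r hr _ => by simp [hτ, Strategy.reportThenStop, hr.trans_le hs]
  have h_price {s : ℕ} (hs : s ≤ t) :
      price p₀ order (Function.update σ (order t) τ) s = price p₀ order σ s := by
    ext ω : 1
    simp only [price, h_history hs]
  induction N, ht using Nat.le_induction with
  | base =>
    rw [payoff_succ, if_pos rfl, price_succ, h_price le_rfl, h_history le_rfl,
      Function.update_self]
    congr 1
    · refine Finset.sum_congr rfl fun s hs => ?_
      have hs : s < t := Finset.mem_range.1 (Finset.mem_filter.1 hs).1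
      rw [h_price hs.le, h_price hs]
    · simp [hτ, Strategy.reportThenStop]
  | succ n hn ih =>
    rw [payoff_succ, ih, add_eq_left, ite_eq_right_iff, sub_eq_zero]
    intro h_order
    have h_stop : (Function.update σ (order t) τ (order n)).act n =
        fun _ _ p => p (Fin.last n) := by
      rw [h_order]
      ext
      simp [hτ, Strategy.reportThenStop, Nat.not_lt_of_lt hn, (Nat.lt_of_succ_le hn).ne']
    rw [price_succ, h_stop, price]

end Play

section Arrivals

variable {J : Type*} {order : ℕ → J} {N t : ℕ} {j : J}

theorem exists_next_arrival {t₀ : ℕ} (ht₀ : t₀ < N) :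
    ∃ t₁, t₀ < t₁ ∧ t₁ ≤ N ∧ (t₁ = N ∨ ∃ k, FirstTrade order N k t₁) ∧
      ∀ t k, t₀ < t → FirstTrade order N k t → t₁ ≤ t := by
  classical
  have h : ∃ t, t₀ < t ∧ (t = N ∨ ∃ k, FirstTrade order N k t) := ⟨N, ht₀, .inl rfl⟩
  exact ⟨Nat.find h, (Nat.find_spec h).1, Nat.find_min' h ⟨ht₀, .inl rfl⟩, (Nat.find_spec h).2,
    fun t k ht hk => Nat.find_min' h ⟨ht, .inr ⟨k, hk⟩⟩⟩

theorem exists_last_trade {t₀ t₁ : ℕ} (h : t₀ < t₁) :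
    ∃ t, t₀ ≤ t ∧ t < t₁ ∧ order t = order t₀ ∧ ∀ r, t < r → r < t₁ → order r ≠ order t := by
  classical
  let trades := (Finset.range t₁).filter fun t => order t = order t₀
  have h_mem {t : ℕ} : t ∈ trades ↔ t < t₁ ∧ order t = order t₀ := by simp [trades]
  have h_nonempty : trades.Nonempty := ⟨t₀, h_mem.2 ⟨h, rfl⟩⟩
  obtain ⟨h_lt, h_order⟩ := h_mem.1 (trades.max'_mem h_nonempty)
  exact ⟨trades.max' h_nonempty, trades.le_max' _ (h_mem.2 ⟨h, rfl⟩), h_lt, h_order,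
    fun r hr hr₁ h_eq => hr.not_ge (trades.le_max' _ (h_mem.2 ⟨hr₁, h_eq.trans h_order⟩))⟩

theorem ArrivalsInformative.not_subset_pooledObs {I : Type*} [DecidableEq I] {obs : J → Finset I}
    (hobs : ArrivalsInformative obs order N) (hj : FirstTrade order N j t) (ht : 0 < t) :
    ¬ obs j ⊆ pooledObs obs order t := by
  obtain ⟨s, hs, h_new⟩ := hobs j t hj ht
  intro h_subset
  obtain ⟨r, hr, hsr⟩ := Finset.mem_biUnion.1 (h_subset hs)
  exact h_new r (Finset.mem_range.1 hr) hsr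

variable [DecidableEq J]

/-- The traders who trade before step `t`. -/
def pastTraders (order : ℕ → J) (t : ℕ) : Finset J :=
  (Finset.range t).image order

theorem mem_pastTraders : j ∈ pastTraders order t ↔ ∃ s < t, order s = j := by
  simp [pastTraders]

theorem pastTraders_succ :
    pastTraders order (t + 1) = insert (order t) (pastTraders order t) := by
  rw [pastTraders, Finset.range_add_one, Finset.image_insert, ← pastTraders]

theorem FirstTrade.notMem_pastTraders (h : FirstTrade order N j t) : j ∉ pastTraders order t := by
  rw [mem_pastTraders]
  rintro ⟨s, hs, hj⟩
  exact h.2.2 s hs hj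

theorem firstTrade_order (ht : t < N) (h : order t ∉ pastTraders order t) :
    FirstTrade order N (order t) t :=
  ⟨ht, rfl, fun s hs hj => h (mem_pastTraders.2 ⟨s, hs, hj⟩)⟩

theorem sub_le_sum_pastTraders_sub {x : J → ℝ} {v : ℕ → ℝ}
    (h_new : ∀ t j, FirstTrade order N j t → v (t + 1) - v t ≤ x j)
    (h_old : ∀ t, order t ∈ pastTraders order t → v (t + 1) = v t) {s : ℕ} (hst : s ≤ t)
    (ht : t ≤ N) :
    v t - v s ≤ ∑ j ∈ pastTraders order t, x j - ∑ j ∈ pastTraders order s, x j := by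
  induction t, hst using Nat.le_induction with
  | base => simp
  | succ t _ ih =>
    specialize ih (Nat.le_of_succ_le ht)
    by_cases h : order t ∈ pastTraders order t
    · rwa [h_old t h, pastTraders_succ, Finset.insert_eq_of_mem h]
    · rw [pastTraders_succ, Finset.sum_insert h]
      linarith [h_new t _ (firstTrade_order ht h)]

theorem sum_pastTraders_eq_sub {x : J → ℝ} {v : ℕ → ℝ}
    (h_new : ∀ t j, FirstTrade order N j t → v (t + 1) - v t ≤ x j)
    (h_old : ∀ t, order t ∈ pastTraders order t → v (t + 1) = v t)
    (h_total : ∑ j ∈ pastTraders order N, x j ≤ v N - v 0) (ht : t ≤ N) :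
    ∑ j ∈ pastTraders order t, x j = v t - v 0 := by
  have h_before := sub_le_sum_pastTraders_sub h_new h_old t.zero_le ht
  have h_after := sub_le_sum_pastTraders_sub h_new h_old ht le_rfl
  have h_zero : ∑ j ∈ pastTraders order 0, x j = 0 := rfl
  linarith

end Arrivals

section Values

variable {I : Type*} {A : I → Type*} [∀ s, MeasurableSpace (A s)]
  {E : Type*} [Fintype E] [MeasurableSpace E] {J : Type*}

/-- The value `V(A_Q)` of the base signals `Q` observed by the traders who trade before step `t`. -/
noncomputable def pooledValue [DecidableEq I] (P : Measure ((∀ s, A s) × E))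
    (S : Prediction E → E → ℝ) (obs : J → Finset I) (order : ℕ → J) (t : ℕ) : ℝ :=
  baseValue P S (pooledObs obs order t)

section PooledValue

variable [DecidableEq I] [DecidableEq J] (P : Measure ((∀ s, A s) × E))
  (S : Prediction E → E → ℝ) (obs : J → Finset I) {order : ℕ → J} {s t : ℕ}

theorem pooledValue_succ_of_mem_pastTraders (h : order t ∈ pastTraders order t) :
    pooledValue P S obs order (t + 1) = pooledValue P S obs order t := by
  obtain ⟨s, hs, h_order⟩ := mem_pastTraders.1 h
  rw [pooledValue, pooledObs_succ, Finset.union_eq_left.2, pooledValue]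
  rw [← h_order]
  exact subset_pooledObs hs

theorem pooledValue_eq_of_forall_mem_pastTraders (hst : s ≤ t)
    (h : ∀ r, s ≤ r → r < t → order r ∈ pastTraders order r) :
    pooledValue P S obs order t = pooledValue P S obs order s := by
  induction t, hst using Nat.le_induction with
  | base => rfl
  | succ t hst ih =>
    rw [pooledValue_succ_of_mem_pastTraders P S obs (h t hst t.lt_succ_self)]
    exact ih fun r hr hrt => h r hr (hrt.trans t.lt_succ_self)

end PooledValue

variable [MeasurableSingletonClass E] [Fintype J]

section Definitions

variable (P : Measure ((∀ s, A s) × E)) [IsProbabilityMeasure P] (S : Prediction E → E → ℝ)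
  {obs : J → Finset I} (order : ℕ → J) (σ : (j : J) → Strategy A E (obs j))

/-- The expected score of the market prediction `p⁽ᵗ⁾`. -/
noncomputable def expectedScore (t : ℕ) : ℝ :=
  ∫ ω, S (price (priorPrediction P) order σ t ω) ω.1.2 ∂(marketMeasure P)

/-- The value of the predictions `p⁽⁰⁾, …, p⁽ᵗ⁾`. -/
noncomputable def historyValue (t : ℕ) : ℝ :=
  marketValue P S (historySignal (priorPrediction P) order σ t)

/-- The value of the information of the trader who trades at step `t`. -/
noncomputable def infoValue (t : ℕ) : ℝ :=
  marketValue P S (traderInfo (priorPrediction P) order σ t)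

/-- Trader `j`'s expected payoff from the steps before `t`. -/
noncomputable def expectedPayoff [DecidableEq J] (t : ℕ) (j : J) : ℝ :=
  ∫ ω, payoff S (priorPrediction P) order t σ j ω ∂(marketMeasure P)

end Definitions

variable {P : Measure ((∀ s, A s) × E)} [IsProbabilityMeasure P] {S : Prediction E → E → ℝ}
  {obs : J → Finset I} {order : ℕ → J} {σ : (j : J) → Strategy A E (obs j)} {t : ℕ}

section Payoffs

variable [DecidableEq J] {j : J}

theorem integrable_payoff
    (h_int : ∀ s ≤ t, Integrable (fun ω => S (price (priorPrediction P) order σ s ω) ω.1.2)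
      (marketMeasure P)) :
    Integrable (payoff S (priorPrediction P) order t σ j) (marketMeasure P) := by
  refine integrable_finsetSum _ fun s hs => ?_
  have hs : s < t := Finset.mem_range.1 (Finset.mem_filter.1 hs).1
  exact (h_int (s + 1) hs).sub (h_int s hs.le)

theorem expectedPayoff_eq_sum
    (h_int : ∀ s ≤ t, Integrable (fun ω => S (price (priorPrediction P) order σ s ω) ω.1.2)
      (marketMeasure P)) :
    expectedPayoff P S order σ t j = ∑ s ∈ Finset.range t with order s = j,
      (expectedScore P S order σ (s + 1) - expectedScore P S order σ s) := by
  have h_lt {s : ℕ} (hs : s ∈ (Finset.range t).filter fun s => order s = j) : s < t :=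
    Finset.mem_range.1 (Finset.mem_filter.1 hs).1
  simp only [expectedPayoff, payoff]
  exact (integral_finsetSum _ fun s hs => (h_int _ (h_lt hs)).sub (h_int _ (h_lt hs).le)).trans
    (Finset.sum_congr rfl fun s hs => integral_sub (h_int _ (h_lt hs)) (h_int _ (h_lt hs).le))

theorem expectedPayoff_succ
    (h_int : ∀ s ≤ t + 1, Integrable (fun ω => S (price (priorPrediction P) order σ s ω) ω.1.2)
      (marketMeasure P)) :
    expectedPayoff P S order σ (t + 1) (order t) = expectedPayoff P S order σ t (order t) +
      (expectedScore P S order σ (t + 1) - expectedScore P S order σ t) := by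
  rw [expectedPayoff_eq_sum h_int, expectedPayoff_eq_sum fun s hs => h_int s (hs.trans t.le_succ)]
  simp only [Finset.sum_filter, Finset.sum_range_succ, if_true]

theorem sum_pastTraders_expectedPayoff
    (h_int : ∀ s ≤ t, Integrable (fun ω => S (price (priorPrediction P) order σ s ω) ω.1.2)
      (marketMeasure P)) :
    ∑ j ∈ pastTraders order t, expectedPayoff P S order σ t j =
      expectedScore P S order σ t - expectedScore P S order σ 0 := by
  simp only [expectedPayoff_eq_sum h_int]
  rw [pastTraders, Finset.sum_fiberwise_of_maps_to fun s hs => Finset.mem_image_of_mem order hs,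
    Finset.sum_range_sub]

theorem expectedPayoff_eq_of_forall_ne {s : ℕ} (hst : s ≤ t)
    (h : ∀ r, s ≤ r → r < t → order r ≠ j) :
    expectedPayoff P S order σ t j = expectedPayoff P S order σ s j := by
  induction t, hst using Nat.le_induction with
  | base => rfl
  | succ t hst ih =>
    rw [← ih fun r hr hrt => h r hr (hrt.trans t.lt_succ_self)]
    simp only [expectedPayoff, payoff_succ, if_neg (h t hst t.lt_succ_self), add_zero]

theorem expectedPayoff_eq_zero (h : j ∉ pastTraders order t) :
    expectedPayoff P S order σ t j = 0 := by
  rw [expectedPayoff_eq_of_forall_ne t.zero_le fun r _ hr h_eq =>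
    h (mem_pastTraders.2 ⟨r, hr, h_eq⟩)]
  simp [expectedPayoff, payoff]

end Payoffs

theorem isPosterior_priorPrediction :
    IsPosterior (marketMeasure (J := J) P) (fun ω => ω.1.2) ⊥ fun _ => priorPrediction P := by
  refine .of_forall fun ω e => ?_
  have h_fst : MeasurePreserving Prod.fst (marketMeasure (J := J) P) P := measurePreserving_fst
  rw [posterior, condExp_bot,
    integral_indicator_const _ (measurable_outcome (measurableSet_singleton e)), smul_eq_mul,
    mul_one]
  exact (h_fst.measureReal_preimage
    (measurable_snd (measurableSet_singleton e)).nullMeasurableSet).symm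

variable (hS : StrictlyProper S) (hSm : ∀ e, Measurable (S · e))
include hS hSm

theorem expectedScore_le_historyValue
    (h_int : Integrable (fun ω => S (price (priorPrediction P) order σ t ω) ω.1.2)
      (marketMeasure P)) :
    expectedScore P S order σ t ≤ historyValue P S order σ t :=
  integral_score_le_signalValue hS hSm measurable_outcome historySignal_le measurable_price h_int

theorem historyValue_le_infoValue : historyValue P S order σ t ≤ infoValue P S order σ t :=
  marketValue_mono hS hSm historySignal_le_traderInfo traderInfo_le

theorem infoValue_mono {s : ℕ} (hst : s ≤ t) (h : order s = order t) :
    infoValue P S order σ s ≤ infoValue P S order σ t :=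
  marketValue_mono hS hSm (traderInfo_mono hst h) traderInfo_le

variable [DecidableEq I]

theorem historyValue_le_pooledValue :
    historyValue P S order σ t ≤ pooledValue P S obs order t :=
  (marketValue_mono hS hSm historySignal_le_prod_pooledObs (prod_baseSignal_le _)).trans_eq
    (marketValue_prod_baseSignal hS hSm _)

theorem expectedScore_zero : expectedScore P S order σ 0 = pooledValue P S obs order 0 := by
  have h_bot : (baseSignal (pooledObs obs order 0)).comap Prod.fst =
      (⊥ : MeasurableSpace (MarketSpace A E J)) := by
    rw [show pooledObs obs order 0 = ∅ from rfl, baseSignal_empty, MeasurableSpace.comap_bot]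
  rw [pooledValue, ← marketValue_comap_baseSignal (J := J) hS hSm, h_bot]
  exact isPosterior_priorPrediction.integral_score measurable_const bot_le measurable_outcome hS hSm

theorem truthfulAt_of_pooledValue_le
    (h_int : Integrable (fun ω => S (price (priorPrediction P) order σ (t + 1) ω) ω.1.2)
      (marketMeasure P))
    (h_info : pooledValue P S obs order (t + 1) ≤ infoValue P S order σ t)
    (h_score : pooledValue P S obs order (t + 1) ≤ expectedScore P S order σ (t + 1)) :
    TruthfulAt P order σ t := by
  intro e
  rw [pooledValue, ← marketValue_prod_baseSignal (J := J) hS hSm] at h_info h_score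
  have h_le : (baseSignal (pooledObs obs order (t + 1))).prod inferInstance ≤
      (Prod.instMeasurableSpace : MeasurableSpace (MarketSpace A E J)) := prod_baseSignal_le _
  filter_upwards [isPosterior_of_signalValue_le hS hSm measurable_outcome h_le
      (measurable_price.mono historySignal_le_prod_pooledObs le_rfl) h_int h_score,
    posterior_ae_eq_of_signalValue_le hS hSm measurable_outcome traderInfo_le_prod_pooledObs
      h_le h_info e] with ω h_price h_info
  rw [h_price, h_info]

end Values

section Equilibrium

variable {I : Type*} {A : I → Type*} [∀ s, MeasurableSpace (A s)]
  {E : Type*} [Fintype E] [MeasurableSpace E] [MeasurableSingletonClass E]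
  {J : Type*} [Fintype J] {P : Measure ((∀ s, A s) × E)} [IsProbabilityMeasure P]
  {S : Prediction E → E → ℝ} {obs : J → Finset I} {order : ℕ → J}
  {σ : (j : J) → Strategy A E (obs j)} {N t : ℕ}
  (hS : StrictlyProper S) (hSm : ∀ e, Measurable (S · e)) (hsubs : StrictStrongSubstitutes P S)

section Substitutes

variable [DecidableEq I]
include hS hSm hsubs

theorem pooledValue_succ_sub_le :
    pooledValue P S obs order (t + 1) - pooledValue P S obs order t ≤
      infoValue P S order σ t - historyValue P S order σ t := by
  simp only [pooledValue, infoValue, historyValue, pooledObs_succ, traderInfo_eq_sup]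
  exact hsubs.baseValue_union_sub_le hS hSm historySignal_le_prod_pooledObs

theorem pooledValue_le_historyValue (hobs : ¬ obs (order t) ⊆ pooledObs obs order t)
    (h : infoValue P S order σ t - historyValue P S order σ t ≤
      pooledValue P S obs order (t + 1) - pooledValue P S obs order t) :
    pooledValue P S obs order t ≤ historyValue P S order σ t := by
  simp only [pooledValue, infoValue, historyValue, pooledObs_succ, traderInfo_eq_sup] at h ⊢
  exact hsubs.baseValue_le_marketValue hS hSm historySignal_le_prod_pooledObs hobs h

end Substitutes

namespace IsBayesNash

variable [DecidableEq J] (hσ : IsBayesNash P S order N σ) {j : J}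
include hS hSm hσ

theorem expectedPayoff_add_infoValue_sub_le (ht : t < N) :
    expectedPayoff P S order σ t (order t) +
        (infoValue P S order σ t - expectedScore P S order σ t) ≤
      expectedPayoff P S order σ N (order t) := by
  have h_out : Measurable fun ω : MarketSpace A E J => ω.1.2 := measurable_outcome
  have h_info : traderInfo (priorPrediction P) order σ t ≤ Prod.instMeasurableSpace :=
    traderInfo_le
  obtain ⟨X, hXm, hX⟩ := exists_isPosterior (μ := marketMeasure P) h_out h_info
  have : Nonempty (Prediction E) := ⟨priorPrediction P⟩
  obtain ⟨f, hf, rfl⟩ := hXm.exists_eq_measurable_comp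
  have h_int := hX.integrable_score hXm h_info h_out hS hSm
  have h_pay : Integrable (payoff S (priorPrediction P) order t σ (order t)) (marketMeasure P) :=
    integrable_payoff fun s hs => hσ.1 s (hs.trans ht.le)
  have h_gain := h_int.sub (hσ.1 t ht.le)
  have h_dev : payoff S (priorPrediction P) order N
      (Function.update σ (order t) ((σ (order t)).reportThenStop t f hf)) (order t) = _ :=
    funext (payoff_reportThenStop S ht hf)
  have h_no_gain := hσ.2 (order t) ((σ (order t)).reportThenStop t f hf)
  rw [h_dev] at h_no_gain
  refine le_trans (le_of_eq ?_) (h_no_gain (h_pay.add h_gain))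
  rw [infoValue, marketValue, ← hX.integral_score hXm h_info h_out hS hSm]
  exact (congrArg _ (integral_sub h_int (hσ.1 t ht.le)).symm).trans
    (integral_add h_pay h_gain).symm

theorem expectedPayoff_le (ht : t ≤ N) :
    expectedPayoff P S order σ t j ≤ expectedPayoff P S order σ N j := by
  induction ht using Nat.decreasingInduction with
  | self => exact le_rfl
  | of_succ t ht ih =>
    rcases eq_or_ne (order t) j with rfl | h
    · linarith [hσ.expectedPayoff_add_infoValue_sub_le hS hSm ht,
        expectedScore_le_historyValue hS hSm (hσ.1 t ht.le),
        historyValue_le_infoValue (P := P) (order := order) (σ := σ) (t := t) hS hSm]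
    · rwa [expectedPayoff_eq_of_forall_ne t.le_succ fun r htr hrt => by
        rwa [Nat.le_antisymm (Nat.le_of_lt_succ hrt) htr]] at ih

theorem infoValue_sub_le_expectedPayoff (hj : FirstTrade order N j t) :
    infoValue P S order σ t - expectedScore P S order σ t ≤ expectedPayoff P S order σ N j := by
  have h_secured := hσ.expectedPayoff_add_infoValue_sub_le hS hSm hj.1
  rwa [hj.2.1, expectedPayoff_eq_zero hj.notMem_pastTraders, zero_add] at h_secured

variable [DecidableEq I]
include hsubs

theorem pooledValue_succ_sub_le_expectedPayoff (hj : FirstTrade order N j t) :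
    pooledValue P S obs order (t + 1) - pooledValue P S obs order t ≤
      expectedPayoff P S order σ N j := by
  linarith [hσ.infoValue_sub_le_expectedPayoff hS hSm hj,
    expectedScore_le_historyValue hS hSm (hσ.1 t hj.1.le),
    pooledValue_succ_sub_le (obs := obs) (order := order) (σ := σ) (t := t) hS hSm hsubs]

theorem sum_pastTraders_expectedPayoff_eq (ht : t ≤ N) :
    ∑ j ∈ pastTraders order t, expectedPayoff P S order σ N j =
      pooledValue P S obs order t - pooledValue P S obs order 0 := by
  refine sum_pastTraders_eq_sub
    (fun t j hj => hσ.pooledValue_succ_sub_le_expectedPayoff hS hSm hsubs hj)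
    (fun t => pooledValue_succ_of_mem_pastTraders P S obs) ?_ ht
  rw [sum_pastTraders_expectedPayoff hσ.1, expectedScore_zero hS hSm]
  exact sub_le_sub_right ((expectedScore_le_historyValue hS hSm (hσ.1 N le_rfl)).trans
    (historyValue_le_pooledValue hS hSm)) _

theorem pooledValue_le_expectedScore_close :
    pooledValue P S obs order N ≤ expectedScore P S order σ N := by
  have h_sum := hσ.sum_pastTraders_expectedPayoff_eq hS hSm hsubs le_rfl
  rw [sum_pastTraders_expectedPayoff hσ.1, expectedScore_zero hS hSm] at h_sum
  linarith

theorem expectedPayoff_firstTrade (hj : FirstTrade order N j t) :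
    expectedPayoff P S order σ N j =
      pooledValue P S obs order (t + 1) - pooledValue P S obs order t := by
  have h_succ := hσ.sum_pastTraders_expectedPayoff_eq hS hSm hsubs (t := t + 1) hj.1
  have h_sum := hσ.sum_pastTraders_expectedPayoff_eq hS hSm hsubs hj.1.le
  rw [pastTraders_succ, hj.2.1, Finset.sum_insert hj.notMem_pastTraders] at h_succ
  linarith

theorem pooledValue_le_expectedScore_firstTrade (hobs : ArrivalsInformative obs order N)
    (hj : FirstTrade order N j t) :
    pooledValue P S obs order t ≤ expectedScore P S order σ t := by
  rcases t.eq_zero_or_pos with rfl | ht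
  · exact (expectedScore_zero hS hSm).ge
  have h_new : ¬ obs (order t) ⊆ pooledObs obs order t := by
    rw [hj.2.1]
    exact hobs.not_subset_pooledObs hj ht
  have h_secured := hσ.infoValue_sub_le_expectedPayoff hS hSm hj
  rw [hσ.expectedPayoff_firstTrade hS hSm hsubs hj] at h_secured
  have h_score := expectedScore_le_historyValue hS hSm (hσ.1 t hj.1.le)
  have h_marginal := pooledValue_succ_sub_le (obs := obs) (order := order) (σ := σ) (t := t)
    hS hSm hsubs
  have h_history : pooledValue P S obs order t ≤ historyValue P S order σ t :=
    pooledValue_le_historyValue hS hSm hsubs h_new (by linarith)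
  linarith

theorem pooledValue_succ_le_infoValue (hobs : ArrivalsInformative obs order N)
    (hj : FirstTrade order N j t) :
    pooledValue P S obs order (t + 1) ≤ infoValue P S order σ t := by
  linarith [hσ.pooledValue_le_expectedScore_firstTrade hS hSm hsubs hobs hj,
    expectedScore_le_historyValue hS hSm (hσ.1 t hj.1.le),
    pooledValue_succ_sub_le (obs := obs) (order := order) (σ := σ) (t := t) hS hSm hsubs]

theorem expectedPayoff_eq_of_pooledValue_le (ht : t ≤ N)
    (h_pooled : pooledValue P S obs order t ≤ expectedScore P S order σ t)
    (hj : j ∈ pastTraders order t) :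
    expectedPayoff P S order σ t j = expectedPayoff P S order σ N j := by
  have h_le : ∀ j ∈ pastTraders order t,
      expectedPayoff P S order σ t j ≤ expectedPayoff P S order σ N j :=
    fun j _ => hσ.expectedPayoff_le hS hSm ht
  refine (Finset.sum_eq_sum_iff_of_le h_le).1 ((Finset.sum_le_sum h_le).antisymm ?_) j hj
  rw [sum_pastTraders_expectedPayoff fun s hs => hσ.1 s (hs.trans ht), expectedScore_zero hS hSm,
    hσ.sum_pastTraders_expectedPayoff_eq hS hSm hsubs ht]
  exact sub_le_sub_right h_pooled _

theorem infoValue_le_expectedScore_succ {t₁ : ℕ} (ht : t < t₁) (ht₁ : t₁ ≤ N)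
    (h_pooled : pooledValue P S obs order t₁ ≤ expectedScore P S order σ t₁)
    (h_last : ∀ r, t < r → r < t₁ → order r ≠ order t) :
    infoValue P S order σ t ≤ expectedScore P S order σ (t + 1) := by
  have h_secured := hσ.expectedPayoff_add_infoValue_sub_le hS hSm (ht.trans_le ht₁)
  have h_final := hσ.expectedPayoff_eq_of_pooledValue_le hS hSm hsubs ht₁ h_pooled
    (mem_pastTraders.2 ⟨t, ht, rfl⟩)
  rw [← h_final, expectedPayoff_eq_of_forall_ne (Nat.succ_le_of_lt ht) h_last,
    expectedPayoff_succ fun s hs => hσ.1 s (hs.trans (ht.trans_le ht₁))] at h_secured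
  linarith

end IsBayesNash

end Equilibrium

theorem mainTheorem1_general {I : Type*} {A : I → Type*} [∀ s, MeasurableSpace (A s)]
    {E : Type*} [Fintype E] [MeasurableSpace E] [MeasurableSingletonClass E]
    {J : Type*} [Fintype J] [DecidableEq J]
    (P : Measure ((∀ s, A s) × E)) [IsProbabilityMeasure P]
    (S : Prediction E → E → ℝ) (hS : StrictlyProper S) (hSm : ∀ e, Measurable fun q => S q e)
    (hsubs : StrictStrongSubstitutes P S)
    (obs : J → Finset I) (order : ℕ → J) (N : ℕ) (hobs : ArrivalsInformative obs order N)
    (σ : (j : J) → Strategy A E (obs j)) (hσ : IsBayesNash P S order N σ) :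
    AllRush P order N σ := by
  classical
  intro j t₀ hj
  obtain ⟨t₁, ht₀₁, ht₁, h_end, h_next⟩ := exists_next_arrival hj.1
  have h_pooled : pooledValue P S obs order t₁ ≤ expectedScore P S order σ t₁ := by
    rcases h_end with rfl | ⟨k, hk⟩
    · exact hσ.pooledValue_le_expectedScore_close hS hSm hsubs
    · exact hσ.pooledValue_le_expectedScore_firstTrade hS hSm hsubs hobs hk
  obtain ⟨t, ht₀, ht, h_order, h_last⟩ := exists_last_trade (order := order) ht₀₁
  have h_const : pooledValue P S obs order (t + 1) = pooledValue P S obs order (t₀ + 1) :=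
    pooledValue_eq_of_forall_mem_pastTraders P S obs (Nat.succ_le_succ ht₀) fun r hr hrt =>
      by_contra fun h => (hrt.trans_le ht).not_ge <|
        h_next r (order r) hr (firstTrade_order ((hrt.trans_le ht).trans_le ht₁) h)
  have h_info : pooledValue P S obs order (t + 1) ≤ infoValue P S order σ t :=
    h_const.trans_le <| (hσ.pooledValue_succ_le_infoValue hS hSm hsubs hobs hj).trans <|
      infoValue_mono hS hSm ht₀ h_order.symm
  have h_score := hσ.infoValue_le_expectedScore_succ hS hSm hsubs ht ht₁ h_pooled h_last
  exact ⟨t, ht.trans_le ht₁, h_order.trans hj.2.1,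
    truthfulAt_of_pooledValue_le hS hSm (hσ.1 (t + 1) (ht.trans_le ht₁)) h_info
      (h_info.trans h_score),
    fun k t₂ hk ht₂ => ht.trans_le (h_next t₂ k ht₂ hk)⟩

theorem mainTheorem1 {I : Type*} [Fintype I] {A : I → Type*} [∀ s, Fintype (A s)]
    [∀ s, MeasurableSpace (A s)] [∀ s, MeasurableSingletonClass (A s)]
    {E : Type*} [Fintype E] [MeasurableSpace E] [MeasurableSingletonClass E]
    {J : Type*} [Fintype J] [DecidableEq J]
    (P : Measure ((∀ s, A s) × E)) [IsProbabilityMeasure P]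
    (S : Prediction E → E → ℝ) (hS : StrictlyProper S) (hSm : ∀ e, Measurable fun q => S q e)
    (hsubs : StrictStrongSubstitutes P S)
    (obs : J → Finset I) (order : ℕ → J) (N : ℕ) (hobs : ArrivalsInformative obs order N)
    (σ : (j : J) → Strategy A E (obs j)) (hσ : IsBayesNash P S order N σ) :
    AllRush P order N σ :=
  mainTheorem1_general P S hS hSm hsubs obs order N hobs σ hσ
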